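/- A complex Euclidean space is a space $\mathbb{C}^{\Sigma}$ for a finite nonempty set $\Sigma$, with $\mathbb{C}^{\Sigma}\otimes\mathbb{C}^{\Gamma}=\mathbb{C}^{\Sigma\times\Gamma}$. For operators $A,B$ on such a space let $\langle A,B\rangle=\operatorname{Tr}(A^{*}B)$, and let $\operatorname{Pos}(\mathcal{H})$ denote the set of positive semidefinite operators on $\mathcal{H}$. For complex Euclidean spaces $\mathcal{X}_1,\dots,\mathcal{X}_n$ and $\mathcal{Y}_1,\dots,\mathcal{Y}_n$, the sets of strategy operators are defined recursively by $$S_1(\mathcal{X}_1;\mathcal{Y}_1)=\{X_1\in\operatorname{Pos}(\mathcal{Y}_1\otimes\mathcal{X}_1):\operatorname{Tr}_{\mathcal{Y}_1}(X_1)=\mathbb{1}_{\mathcal{X}_1}\}$$ and, for $2\le k\le n$, $S_k(\mathcal{X}_1,\dots,\mathcal{X}_k;\mathcal{Y}_1,\dots,\mathcal{Y}_k)$ is the set of all $X_k\in\operatorname{Pos}(\mathcal{Y}_1\otimes\cdots\otimes\mathcal{Y}_k\otimes\mathcal{X}_1\otimes\cdots\otimes\mathcal{X}_k)$ such that $\operatorname{Tr}_{\mathcal{Y}_k}(X_k)=X_{k-1}\otimes\mathbb{1}_{\mathcal{X}_k}$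 for some $X_{k-1}\in S_{k-1}(\mathcal{X}_1,\dots,\mathcal{X}_{k-1};\mathcal{Y}_1,\dots,\mathcal{Y}_{k-1})$. Let $W$ be the isometry from $\mathcal{Y}_1\otimes\cdots\otimes\mathcal{Y}_n\otimes\mathcal{X}_1\otimes\cdots\otimes\mathcal{X}_n$ onto $\mathcal{X}_n\otimes\cdots\otimes\mathcal{X}_1\otimes\mathcal{Y}_n\otimes\cdots\otimes\mathcal{Y}_1$ given by $$W(y_1\otimes\cdots\otimes y_n\otimes x_1\otimes\cdots\otimes x_n)=x_n\otimes\cdots\otimes x_1\otimes y_n\otimes\cdots\otimes y_1.$$ Theorem. Let $n$ be a positive integer, let $\mathcal{X}_1,\dots,\mathcal{X}_n$ and $\mathcal{Y}_1,\dots,\mathcal{Y}_n$ be complex Euclidean spaces, let $u\in\mathcal{Y}_1\otimes\cdots\otimes\mathcal{Y}_n\otimes\mathcal{X}_1\otimes\cdots\otimes\mathcal{X}_n$ be a vector, and let $X\in S_n(\mathcal{X}_1,\dots,\mathcal{X}_n;\mathcal{Y}_1,\dots,\mathcal{Y}_n)$. There exists $Y\in S_n(\mathcal{Y}_n,\dots,\mathcal{Y}_1;\mathcal{X}_n,\dots,\mathcal{X}_1)$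 such that $$\langle Wuu^{*}W^{*},Y\rangle\ge\langle uu^{*},X\rangle.$$ If $\dim(\mathcal{Y}_1\otimes\cdots\otimes\mathcal{Y}_n)\le\dim(\mathcal{X}_1\otimes\cdots\otimes\mathcal{X}_n)$, then $Y$ may be chosen so that equality holds. -/

import Mathlib

open scoped Matrix Kronecker ComplexOrder

universe uX uY

noncomputable section

namespace QStrategy

/-!
Complex Euclidean spaces are the spaces `ℂ^Σ` for a finite nonempty index set `Σ` (the set of
standard basis states), and `ℂ^Σ ⊗ ℂ^Γ = ℂ^(Σ × Γ)`. Operators are matrices with respect to the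
standard bases. A list of spaces is given by the family of its index sets.
-/

/-- The standard basis of `𝒴₁ ⊗ ⋯ ⊗ 𝒴ₙ ⊗ 𝒳₁ ⊗ ⋯ ⊗ 𝒳ₙ`, where `𝒴ᵢ = ℂ^(Y i)`, `𝒳ᵢ = ℂ^(X i)`. -/
abbrev Idx {n : ℕ} (Y : Fin n → Type uY) (X : Fin n → Type uX) : Type (max uX uY) :=
  (∀ i, Y i) × (∀ i, X i)

/-- The operators on `𝒴₁ ⊗ ⋯ ⊗ 𝒴ₙ ⊗ 𝒳₁ ⊗ ⋯ ⊗ 𝒳ₙ`. -/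
abbrev Op {n : ℕ} (Y : Fin n → Type uY) (X : Fin n → Type uX) : Type (max uX uY) :=
  Matrix (Idx Y X) (Idx Y X) ℂ

/-- The partial trace over the last output space, from operators on
`𝒴₁ ⊗ ⋯ ⊗ 𝒴ₙ₊₁ ⊗ 𝒳₁ ⊗ ⋯ ⊗ 𝒳ₙ₊₁` to operators on `𝒴₁ ⊗ ⋯ ⊗ 𝒴ₙ ⊗ 𝒳₁ ⊗ ⋯ ⊗ 𝒳ₙ₊₁`. -/
def partialTraceLast {n : ℕ} (Y : Fin (n + 1) → Type uY) (X : Fin (n + 1) → Type uX)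
    [∀ i, Fintype (Y i)] (M : Op Y X) :
    Matrix ((∀ i : Fin n, Y i.castSucc) × (∀ i, X i))
      ((∀ i : Fin n, Y i.castSucc) × (∀ i, X i)) ℂ :=
  fun p q => ∑ b : Y (Fin.last n),
    M (Fin.snoc (α := Y) p.1 b, p.2) (Fin.snoc (α := Y) q.1 b, q.2)

/-- The operator `N ⊗ 𝟙` on `𝒴₁ ⊗ ⋯ ⊗ 𝒴ₙ ⊗ 𝒳₁ ⊗ ⋯ ⊗ 𝒳ₙ₊₁`, for an operator `N` on
`𝒴₁ ⊗ ⋯ ⊗ 𝒴ₙ ⊗ 𝒳₁ ⊗ ⋯ ⊗ 𝒳ₙ` and the identity `𝟙` on `𝒳ₙ₊₁`. -/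
def tensorIdLast {n : ℕ} (Y : Fin (n + 1) → Type uY) (X : Fin (n + 1) → Type uX)
    [∀ i, DecidableEq (X i)]
    (N : Op (fun i : Fin n => Y i.castSucc) (fun i : Fin n => X i.castSucc)) :
    Matrix ((∀ i : Fin n, Y i.castSucc) × (∀ i, X i))
      ((∀ i : Fin n, Y i.castSucc) × (∀ i, X i)) ℂ :=
  (N ⊗ₖ (1 : Matrix (X (Fin.last n)) (X (Fin.last n)) ℂ)).submatrix
    (fun p => ((p.1, Fin.init (α := X) p.2), p.2 (Fin.last n)))
    (fun p => ((p.1, Fin.init (α := X) p.2), p.2 (Fin.last n)))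

/-- The set `S_n(𝒳₁,…,𝒳ₙ; 𝒴₁,…,𝒴ₙ)` of `n`-turn strategy operators, by recursion on `n`.
For `n = 0` the only strategy operator is the scalar `1` on `ℂ`, so that the condition for one turn
reads `X₁ ≥ 0` and `Tr_{𝒴₁} X₁ = 𝟙_{𝒳₁}`. -/
def strategyOps : (n : ℕ) → (X : Fin n → Type uX) → (Y : Fin n → Type uY) →
    [∀ i, Fintype (X i)] → [∀ i, DecidableEq (X i)] →
    [∀ i, Fintype (Y i)] → [∀ i, DecidableEq (Y i)] → Set (Op Y X)
  | 0, _, _, _, _, _, _ => {1}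
  | n + 1, X, Y, _, _, _, _ =>
    {M | M.PosSemidef ∧
      ∃ N ∈ strategyOps n (fun i => X i.castSucc) (fun i => Y i.castSucc),
        partialTraceLast Y X M = tensorIdLast Y X N}

/-- The isometry `W (y₁ ⊗ ⋯ ⊗ yₙ ⊗ x₁ ⊗ ⋯ ⊗ xₙ) = xₙ ⊗ ⋯ ⊗ x₁ ⊗ yₙ ⊗ ⋯ ⊗ y₁`, as a matrix. -/
def reversal {n : ℕ} (Y : Fin n → Type uY) (X : Fin n → Type uX)
    [∀ i, DecidableEq (X i)] [∀ i, DecidableEq (Y i)] :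
    Matrix (Idx (fun i => X i.rev) (fun i => Y i.rev)) (Idx Y X) ℂ :=
  fun q p =>
    if q = (fun i : Fin n => p.2 i.rev, fun i : Fin n => p.1 i.rev) then 1 else 0

/-- The Hilbert–Schmidt inner product `⟨A, B⟩ = Tr (A* B)`. -/
def hsInner {ι : Type*} [Fintype ι] (A B : Matrix ι ι ℂ) : ℂ := (Aᴴ * B).trace

/-- The rank-one operator `w w*`. -/
def rankOne {ι : Type*} (w : ι → ℂ) : Matrix ι ι ℂ := Matrix.vecMulVec w (star w)

end QStrategy

end

/-!
The idea is to run a strategy backwards. Write `P` as a sequence of unitaries, one for each turn,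
acting on the message of the turn and on a memory: this is a family of vectors `v s r`, indexed by
basis states `s` of the initial memory `ℂ^S` and `r` of the final memory `ℂ^R`, such that
`P = ∑ r, (v s₀ r) (v s₀ r)*` for some `s₀` (`exists_dilation`). The transposed unitaries, taken in
the opposite order, are again unitary. Hence, if the memory starts in any pure state of `ℂ^R` and
`ℂ^S` is traced out at the end, the same vectors define a strategy for the reversed order of turns.

Let `G` be the matrix with entries `G s r = ⟨u, v s r⟩`. The value of `P` is then the squared length
`(G Gᴴ) s₀ s₀` of row `s₀`, and the reversed strategies that arise from unit vectors `z` have the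
values `‖G z‖²` (`exists_strategy_value_eq`). Normalizing the conjugate of row `s₀` gives a `z` with
a value at least as large. Since all turns are unitary, `dim 𝒳 * card S = dim 𝒴 * card R`; so if
`dim 𝒴 ≤ dim 𝒳`, then `G` has at least as many columns as rows, and a polar-type argument
(`exists_unit_vector_sq_eq`) gives a `z` with exactly the same value.

The dilation is built by induction on the number of turns. Let `N` be the operator with
`Tr_{𝒴ₙ₊₁} P = N ⊗ 𝟙`, and factor `P = C C*` and `N = B B*`, the latter by the dilation of `N`. If
the last output is counted as a column index of `C`, the condition says that `C` and `B ⊗ 𝟙` have the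
same Gram matrix of rows. Hence they are related by a unitary (`exists_unitary_eq_mul`), which is the
last turn. That the reversed composition is a strategy is `appendTurn_mem_revStrategyOps`.
-/

noncomputable section

namespace QStrategy

universe w

/-! ### Matrices with equal Gram matrices, and lengths of images of unit vectors -/

/-- Matrices with the same Gram matrix of rows differ by a unitary: `Bᴴ x ↦ Mᴴ x` is a well-defined
isometry on the range of `Bᴴ`, and it extends to the whole space. -/
theorem exists_unitary_eq_mul {m k : Type*} [Fintype m] [Fintype k] [DecidableEq k]
    (M B : Matrix m k ℂ) (h : M * Mᴴ = B * Bᴴ) :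
    ∃ U ∈ Matrix.unitaryGroup k ℂ, M = B * U := by
  classical
  let f := Matrix.toEuclideanLin Bᴴ
  let g := Matrix.toEuclideanLin Mᴴ
  have key : ∀ A : Matrix m k ℂ, ∀ x : EuclideanSpace ℂ m,
      inner ℂ (Matrix.toEuclideanLin Aᴴ x) (Matrix.toEuclideanLin Aᴴ x)
        = (A * Aᴴ) *ᵥ x.ofLp ⬝ᵥ star x.ofLp := by
    intro A x
    rw [EuclideanSpace.inner_eq_star_dotProduct]
    simp only [Matrix.toEuclideanLin, Matrix.toLpLin_apply]
    rw [Matrix.star_mulVec, Matrix.conjTranspose_conjTranspose, dotProduct_comm,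
      ← Matrix.dotProduct_mulVec, dotProduct_comm, Matrix.mulVec_mulVec]
  have hnorm : ∀ x, ‖g x‖ = ‖f x‖ := by
    intro x
    have h1 : inner ℂ (g x) (g x) = inner ℂ (f x) (f x) := by
      rw [key, key, h]
    rw [inner_self_eq_norm_sq_to_K, inner_self_eq_norm_sq_to_K] at h1
    have h2 : ‖g x‖ ^ 2 = ‖f x‖ ^ 2 := by exact_mod_cast h1
    exact (sq_eq_sq₀ (norm_nonneg _) (norm_nonneg _)).1 h2
  have hker : f.ker ≤ g.ker := by
    intro x hx
    rw [LinearMap.mem_ker] at hx ⊢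
    rw [← norm_eq_zero, hnorm, hx, norm_zero]
  let L₀ : f.range →ₗ[ℂ] EuclideanSpace ℂ k :=
    (f.ker.liftQ g hker).comp f.quotKerEquivRange.symm.toLinearMap
  have hL₀ : ∀ x, L₀ ⟨f x, LinearMap.mem_range_self f x⟩ = g x := by
    intro x
    have : f.quotKerEquivRange.symm ⟨f x, LinearMap.mem_range_self f x⟩
        = Submodule.Quotient.mk x := by
      rw [LinearEquiv.symm_apply_eq]
      exact Subtype.ext (by simp)
    simp [L₀, this]
  let L₁ : f.range →ₗᵢ[ℂ] EuclideanSpace ℂ k :=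
    ⟨L₀, by
      rintro ⟨_, x, rfl⟩
      rw [hL₀, hnorm]; rfl⟩
  let L := L₁.extend
  have hL : ∀ x, L (f x) = g x := fun x =>
    (L₁.extend_apply ⟨f x, LinearMap.mem_range_self f x⟩).trans (hL₀ x)
  let T : Matrix k k ℂ := Matrix.of fun a i => L (EuclideanSpace.single i 1) a
  have hTL : ∀ x a, L x a = ∑ i, T a i * x i := by
    intro x a
    have hx : x = ∑ i, x i • EuclideanSpace.single i (1 : ℂ) := by
      ext j
      simp [Finset.sum_apply, Pi.single_apply]
    conv_lhs => rw [hx]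
    simp [T, mul_comm]
  have hTT : Tᴴ * T = 1 := by
    ext i j
    have := L.inner_map_map (EuclideanSpace.single i (1 : ℂ)) (EuclideanSpace.single j 1)
    rw [EuclideanSpace.inner_single_left, EuclideanSpace.inner_eq_star_dotProduct] at this
    simp only [Matrix.mul_apply, Matrix.conjTranspose_apply, T, Matrix.of_apply, Matrix.one_apply]
    simp only [dotProduct, map_one, one_mul, Pi.star_apply] at this
    simp_rw [mul_comm (star _)]
    rw [this]
    simp
  have hM : Mᴴ = T * Bᴴ := by
    ext a i
    have := congrArg (fun v : EuclideanSpace ℂ k => v a) (hL (EuclideanSpace.single i 1))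
    simp only [hTL] at this
    simpa [f, g, Matrix.toEuclideanLin, Matrix.toLpLin_apply, Matrix.mul_apply] using this.symm
  refine ⟨Tᴴ, ?_, ?_⟩
  · rw [Matrix.mem_unitaryGroup_iff, Matrix.star_eq_conjTranspose,
      Matrix.conjTranspose_conjTranspose, hTT]
  · rw [← Matrix.conjTranspose_conjTranspose M, hM, Matrix.conjTranspose_mul,
      Matrix.conjTranspose_conjTranspose]

open scoped MatrixOrder Matrix.Norms.L2Operator in
theorem exists_eq_mul_conjTranspose {m : Type*} [Fintype m] {A : Matrix m m ℂ}
    (hA : A.PosSemidef) : ∃ C : Matrix m m ℂ, A = C * Cᴴ := by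
  classical
  obtain ⟨C, hC⟩ := CStarAlgebra.nonneg_iff_eq_star_mul_self.mp hA.nonneg
  exact ⟨Cᴴ, by rw [hC, Matrix.conjTranspose_conjTranspose, Matrix.star_eq_conjTranspose]⟩

theorem exists_unitary_conj_of_charpoly_eq {m : Type*} [Fintype m] [DecidableEq m]
    {A B : Matrix m m ℂ} (hA : A.IsHermitian) (hB : B.IsHermitian) (h : A.charpoly = B.charpoly) :
    ∃ W ∈ Matrix.unitaryGroup m ℂ, A = W * B * Wᴴ := by
  have he := (hA.eigenvalues_eq_eigenvalues_iff hB).2 h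
  have h1 := hA.spectral_theorem
  have h2 := hB.spectral_theorem
  rw [Unitary.conjStarAlgAut_apply] at h1 h2
  rw [he] at h1
  set D := Matrix.diagonal ((RCLike.ofReal : ℝ → ℂ) ∘ hB.eigenvalues)
  set UA := hA.eigenvectorUnitary
  set UB := hB.eigenvectorUnitary
  refine ⟨UA * (star UB : Matrix.unitaryGroup m ℂ), (UA * star UB).2, ?_⟩
  have e : (star (UB : Matrix m m ℂ)) * UB = 1 := Unitary.coe_star_mul_self UB
  rw [← Matrix.star_eq_conjTranspose, star_mul]
  simp only [Unitary.coe_star, star_star]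
  conv_lhs => rw [h1]
  conv_rhs => rw [h2]
  calc (UA : Matrix m m ℂ) * D * star (UA : Matrix m m ℂ)
      = UA * 1 * D * 1 * star (UA : Matrix m m ℂ) := by simp
    _ = _ := by rw [← e]; simp only [mul_assoc]

/-- Some unit vector is stretched by `G` at least as much as row `s₀` is long; the normalized
conjugate of that row is one. -/
theorem exists_unit_vector_sq_le {S R : Type*} [Fintype S] [Fintype R] [Nonempty R]
    (G : Matrix S R ℂ) (s₀ : S) :
    ∃ z : R → ℂ, star z ⬝ᵥ z = 1 ∧ (G * Gᴴ) s₀ s₀ ≤ star (G *ᵥ z) ⬝ᵥ (G *ᵥ z) := by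
  classical
  set c : ℂ := (G * Gᴴ) s₀ s₀ with hc
  have hcsum : c = ((∑ r, ‖G s₀ r‖ ^ 2 : ℝ) : ℂ) := by
    rw [hc, Matrix.mul_apply]
    push_cast
    exact Finset.sum_congr rfl fun r _ => by
      rw [Matrix.conjTranspose_apply]; exact Complex.mul_conj' _
  obtain ⟨t, ht0, hct⟩ : ∃ t : ℝ, 0 ≤ t ∧ c = t := ⟨_, by positivity, hcsum⟩
  rcases ht0.eq_or_lt with h0 | hpos
  · obtain ⟨r⟩ := ‹Nonempty R›
    refine ⟨Pi.single r 1, by simp, ?_⟩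
    rw [hct, ← h0, Complex.ofReal_zero]
    exact dotProduct_star_self_nonneg _
  · -- The factor `q` normalizes the conjugate of row `s₀`, whose squared length is `t`.
    let q : ℂ := ((Real.sqrt t)⁻¹ : ℝ)
    have hq : q * q * t = 1 := by
      have h3 : (Real.sqrt t)⁻¹ * (Real.sqrt t)⁻¹ * t = 1 := by
        rw [← mul_inv, Real.mul_self_sqrt ht0, inv_mul_cancel₀ hpos.ne']
      simpa [q] using congrArg (Complex.ofReal) h3
    have hqs : star q = q := Complex.conj_ofReal _
    have hrow : ∑ r, G s₀ r * star (G s₀ r) = t := by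
      rw [← hct, hc, Matrix.mul_apply]; rfl
    refine ⟨fun r => q * star (G s₀ r), ?_, ?_⟩
    · rw [← hq, ← hrow, Finset.mul_sum]
      simp only [dotProduct, Pi.star_apply, star_mul', star_star, hqs]
      exact Finset.sum_congr rfl fun r _ => by ring
    · have h1 : (G *ᵥ fun r => q * star (G s₀ r)) s₀ = q * t := by
        rw [← hrow, Finset.mul_sum]
        simp only [Matrix.mulVec, dotProduct]
        exact Finset.sum_congr rfl fun r _ => by ring
      calc c = star ((G *ᵥ fun r => q * star (G s₀ r)) s₀) *
            (G *ᵥ fun r => q * star (G s₀ r)) s₀ := by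
              rw [h1, hct, star_mul', hqs]
              have : star (t : ℂ) = t := Complex.conj_ofReal _
              rw [this]
              linear_combination (-(t : ℂ)) * hq
        _ ≤ _ := Finset.single_le_sum
              (f := fun s => star ((G *ᵥ fun r => q * star (G s₀ r)) s) *
                (G *ᵥ fun r => q * star (G s₀ r)) s)
              (fun s _ => star_mul_self_nonneg _) (Finset.mem_univ s₀)

/-- With at least as many columns as rows, the length of row `s₀` is attained exactly by `‖G z‖` for
a unit vector `z`: after padding `G` by zero rows to a square matrix, `G Gᴴ` and `Gᴴ G` have the same
characteristic polynomial and are unitarily conjugate. -/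
theorem exists_unit_vector_sq_eq {S R : Type*} [Fintype S] [Fintype R]
    (G : Matrix S R ℂ) (s₀ : S) (hSR : Fintype.card S ≤ Fintype.card R) :
    ∃ z : R → ℂ, star z ⬝ᵥ z = 1 ∧ star (G *ᵥ z) ⬝ᵥ (G *ᵥ z) = (G * Gᴴ) s₀ s₀ := by
  classical
  obtain ⟨f⟩ := Function.Embedding.nonempty_of_card_le hSR
  -- `G'` is `G` with its rows moved along `f` and all other rows zero.
  let G' : Matrix R R ℂ := Matrix.of fun a r => if h : ∃ s, f s = a then G h.choose r else 0
  have hG' : ∀ s r, G' (f s) r = G s r := by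
    intro s r
    have h : ∃ s', f s' = f s := ⟨s, rfl⟩
    simp only [G', Matrix.of_apply, dif_pos h]
    rw [f.injective h.choose_spec]
  have hG0 : ∀ a, (∀ s, f s ≠ a) → ∀ r, G' a r = 0 := by
    intro a ha r
    have h : ¬ ∃ s, f s = a := fun ⟨s, hs⟩ => ha s hs
    simp only [G', Matrix.of_apply, dif_neg h]
  have hcol : G'ᴴ * G' = Gᴴ * G := by
    ext i j
    simp only [Matrix.mul_apply, Matrix.conjTranspose_apply]
    rw [← Finset.sum_subset (Finset.subset_univ (Finset.univ.map f))]
    · simp [hG']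
    · intro a _ ha
      rw [hG0 a (fun s hs => ha (by simp [← hs])), star_zero, zero_mul]
  have hrow : (G' * G'ᴴ) (f s₀) (f s₀) = (G * Gᴴ) s₀ s₀ := by
    simp only [Matrix.mul_apply, Matrix.conjTranspose_apply, hG']
  obtain ⟨W, hW, hWG⟩ := exists_unitary_conj_of_charpoly_eq
    (Matrix.isHermitian_mul_conjTranspose_self G') (Matrix.isHermitian_conjTranspose_mul_self G')
    (Matrix.charpoly_mul_comm _ _)
  refine ⟨Wᴴ *ᵥ Pi.single (f s₀) 1, ?_, ?_⟩
  · rw [Matrix.star_mulVec, Matrix.conjTranspose_conjTranspose, Matrix.dotProduct_mulVec,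
      Matrix.vecMul_vecMul, ← Matrix.star_eq_conjTranspose W, Matrix.mem_unitaryGroup_iff.1 hW]
    simp
  · rw [← hrow, hWG, hcol, Matrix.star_mulVec, Matrix.dotProduct_mulVec, Matrix.vecMul_vecMul,
      Matrix.star_mulVec, Matrix.conjTranspose_conjTranspose, Matrix.dotProduct_mulVec,
      Matrix.vecMul_vecMul, Matrix.vecMul_vecMul]
    simp [Matrix.mul_assoc]

/-! ### Reversed strategies with an extra input at the start -/

/-- Strategy operators for the reversed order of turns, in which an extra input register `ℂ^R` is
received at the very start. The families `X`, `Y` keep their original order, so that the turns run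
from `Fin.last` down to `0`: the space `X 0` is the last output and `Y 0` is the last input. Without
turns, the only operator is the identity on `ℂ^R`. -/
def revStrategyOps (R : Type w) [DecidableEq R] :
    (n : ℕ) → (X : Fin n → Type uX) → (Y : Fin n → Type uY) →
    [∀ i, Fintype (X i)] → [∀ i, DecidableEq (Y i)] → Set (Matrix (R × Idx Y X) (R × Idx Y X) ℂ)
  | 0, _, _, _, _ => {fun p q => if p.1 = q.1 then 1 else 0}
  | n + 1, X, Y, _, _ =>
    {M | M.PosSemidef ∧
      ∃ N ∈ revStrategyOps R n (fun i => X i.succ) (fun i => Y i.succ),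
        ∀ (r r' : R) (y y' : ∀ i, Y i) (x x' : ∀ i : Fin n, X i.succ),
          ∑ b : X 0, M (r, y, Fin.cons b x) (r', y', Fin.cons b x') =
            if y 0 = y' 0 then N (r, Fin.tail y, x) (r', Fin.tail y', x') else 0}

theorem posSemidef_of_mem_revStrategyOps {R : Type w} [DecidableEq R] [Fintype R] :
    ∀ {n : ℕ} {X : Fin n → Type uX} {Y : Fin n → Type uY}
      [∀ i, Fintype (X i)] [∀ i, Fintype (Y i)] [∀ i, DecidableEq (Y i)]
      {Z : Matrix (R × Idx Y X) (R × Idx Y X) ℂ}, Z ∈ revStrategyOps R n X Y → Z.PosSemidef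
  | 0, X, Y, _, _, _, Z, h => by
    rw [Set.mem_singleton_iff.1 h]
    exact (Matrix.PosSemidef.one (n := R) (R := ℂ)).submatrix (Prod.fst : R × Idx Y X → R)
  | _ + 1, _, _, _, _, _, _, h => h.1

/-- The composition of `Z`, a reversed strategy that starts from the register `ℂ^R'`, with an
earlier turn: the map with Kraus operators `a e`, `e ∈ E`, which receives `ℂ^R` and the last space of `Y`,
and returns the last space of `X` and the register `ℂ^R'`. -/
def appendTurn {n : ℕ} {X : Fin (n + 1) → Type uX} {Y : Fin (n + 1) → Type uY} {E R R' : Type w}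
    [Fintype E] [Fintype R']
    (a : E → R → Y (Fin.last n) → X (Fin.last n) → R' → ℂ)
    (Z : Matrix (R' × Idx (fun i : Fin n => Y i.castSucc) (fun i : Fin n => X i.castSucc))
      (R' × Idx (fun i : Fin n => Y i.castSucc) (fun i : Fin n => X i.castSucc)) ℂ) :
    Matrix (R × Idx Y X) (R × Idx Y X) ℂ :=
  fun p q => ∑ e, ∑ k, ∑ l, a e p.1 (p.2.1 (Fin.last n)) (p.2.2 (Fin.last n)) k *
    Z (k, Fin.init p.2.1, Fin.init p.2.2) (l, Fin.init q.2.1, Fin.init q.2.2) *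
    star (a e q.1 (q.2.1 (Fin.last n)) (q.2.2 (Fin.last n)) l)

/-- Composing with a turn acts on the vectors of a decomposition of `Z` into rank-one terms. -/
theorem appendTurn_eq {n : ℕ} {X : Fin (n + 1) → Type uX} {Y : Fin (n + 1) → Type uY}
    {E R R' : Type w} [Fintype E] [Fintype R'] {κ : Type*} [Fintype κ]
    (a : E → R → Y (Fin.last n) → X (Fin.last n) → R' → ℂ)
    (c : κ → R' × Idx (fun i : Fin n => Y i.castSucc) (fun i : Fin n => X i.castSucc) → ℂ) :
    appendTurn a (fun p q => ∑ m, c m p * star (c m q)) = fun p q => ∑ em : E × κ,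
      (∑ k, a em.1 p.1 (p.2.1 (Fin.last n)) (p.2.2 (Fin.last n)) k *
        c em.2 (k, Fin.init p.2.1, Fin.init p.2.2)) *
      star (∑ k, a em.1 q.1 (q.2.1 (Fin.last n)) (q.2.2 (Fin.last n)) k *
        c em.2 (k, Fin.init q.2.1, Fin.init q.2.2)) := by
  ext p q
  rw [Fintype.sum_prod_type]
  refine Finset.sum_congr rfl fun e _ => ?_
  simp_rw [star_sum, Finset.sum_mul_sum, Finset.mul_sum, Finset.sum_mul, star_mul']
  rw [Finset.sum_comm_cycle]
  exact Finset.sum_congr rfl fun _ _ => Finset.sum_congr rfl fun _ _ =>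
    Finset.sum_congr rfl fun _ _ => by ring

theorem posSemidef_sum_mul_star {ι κ : Type*} [Fintype ι] [Fintype κ] (c : κ → ι → ℂ) :
    (Matrix.of fun p q => ∑ m, c m p * star (c m q)).PosSemidef :=
  Matrix.posSemidef_self_mul_conjTranspose (Matrix.of fun p m => c m p)

theorem posSemidef_appendTurn {n : ℕ} {X : Fin (n + 1) → Type uX} {Y : Fin (n + 1) → Type uY}
    [∀ i, Fintype (X i)] [∀ i, Fintype (Y i)] {E R R' : Type w} [Fintype E] [Fintype R] [Fintype R']
    (a : E → R → Y (Fin.last n) → X (Fin.last n) → R' → ℂ)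
    {Z : Matrix (R' × Idx (fun i : Fin n => Y i.castSucc) (fun i : Fin n => X i.castSucc))
      (R' × Idx (fun i : Fin n => Y i.castSucc) (fun i : Fin n => X i.castSucc)) ℂ}
    (hZ : Z.PosSemidef) : (appendTurn a Z).PosSemidef := by
  obtain ⟨C, hC⟩ := exists_eq_mul_conjTranspose hZ
  have : Z = fun p q => ∑ m, C p m * star (C q m) := by rw [hC]; rfl
  rw [this, appendTurn_eq a fun m p => C p m]
  exact posSemidef_sum_mul_star _

/-- Composing a reversed strategy with a trace-preserving earlier turn gives a reversed strategy.
The last output is traced out at the other end of the composition, so that the recursion for `Z` passes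
through; without turns in `Z` it is the trace preservation of the new turn. -/
theorem appendTurn_mem_revStrategyOps {R : Type w} [DecidableEq R] [Fintype R]
    {R' : Type w} [DecidableEq R'] [Fintype R'] {E : Type w} [Fintype E] :
    ∀ {n : ℕ} {X : Fin (n + 1) → Type uX} {Y : Fin (n + 1) → Type uY}
      [∀ i, Fintype (X i)] [∀ i, Fintype (Y i)] [∀ i, DecidableEq (Y i)]
      (a : E → R → Y (Fin.last n) → X (Fin.last n) → R' → ℂ)
      (_ : ∀ r y r' y', ∑ x, ∑ e, ∑ k, a e r y x k * star (a e r' y' x k) =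
        if r = r' ∧ y = y' then 1 else 0)
      {Z} (_ : Z ∈ revStrategyOps R' n (fun i => X i.castSucc) (fun i => Y i.castSucc)),
      appendTurn a Z ∈ revStrategyOps R (n + 1) X Y := by
  intro n
  induction n with
  | zero =>
    intro X Y _ _ _ a ha Z hZ
    refine ⟨posSemidef_appendTurn a (posSemidef_of_mem_revStrategyOps hZ), _, rfl, ?_⟩
    intro r r' y y' x x'
    rw [Set.mem_singleton_iff.1 hZ]
    have := ha r (y 0) r' (y' 0)
    simp only [appendTurn]
    simp only [mul_ite, mul_one, mul_zero, ite_mul, zero_mul, Finset.sum_ite_eq, Finset.mem_univ,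
      if_true]
    refine Eq.trans this ?_
    by_cases h1 : r = r' <;> by_cases h2 : y 0 = y' 0 <;> simp [h1, h2]
  | succ n ih =>
    intro X Y _ _ _ a ha Z hZ
    obtain ⟨hpos, N, hN, hZN⟩ := hZ
    refine ⟨posSemidef_appendTurn a hpos, _,
      ih (X := fun i => X i.succ) (Y := fun i => Y i.succ) a ha hN, ?_⟩
    intro r r' y y' x x'
    have hinit : ∀ (b : X 0) (x : ∀ i : Fin (n + 1), X i.succ),
        (Fin.init (Fin.cons b x : ∀ i, X i) : ∀ i : Fin (n + 1), X i.castSucc) =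
          Fin.cons (α := fun i : Fin (n + 1) => X i.castSucc) b
            (Fin.init (α := fun i : Fin (n + 1) => X i.succ) x) := by
      intro b x
      funext i
      refine Fin.cases ?_ (fun j => ?_) i
      · rfl
      · rfl
    simp only [appendTurn, hinit]
    have hlast : ∀ (b : X 0) (x : ∀ i : Fin (n + 1), X i.succ),
        (Fin.cons b x : ∀ i, X i) (Fin.last (n + 1)) = x (Fin.last n) := fun _ _ => rfl
    simp only [hlast]
    rw [Finset.sum_comm]
    simp_rw [Finset.sum_comm (s := (Finset.univ : Finset (X 0)))]
    simp_rw [← Finset.sum_mul, ← Finset.mul_sum]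
    have key : ∀ k l, _ := fun k l => hZN k l (Fin.init y) (Fin.init y')
      (Fin.init (α := fun i : Fin (n + 1) => X i.succ) x)
      (Fin.init (α := fun i : Fin (n + 1) => X i.succ) x')
    split_ifs with hy
    · refine Finset.sum_congr rfl fun e _ => Finset.sum_congr rfl fun k _ =>
        Finset.sum_congr rfl fun l _ => ?_
      congr 2
      exact (key k l).trans (if_pos hy)
    · refine Finset.sum_eq_zero fun e _ => Finset.sum_eq_zero fun k _ =>
        Finset.sum_eq_zero fun l _ => ?_
      rw [show ∑ i : X 0, Z _ _ = 0 from (key k l).trans (if_neg hy), mul_zero, zero_mul]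

/-! ### Unitary dilation of a strategy operator -/

/-- The unitary that implements one turn. The vectors `c`, with the output index `B` traced out,
have the Gram matrix `N ⊗ 𝟙`, and so have the vectors `b ⊗ 𝟙`. After both families are placed in the
common space indexed by `R × A × B × F`, by attaching the fixed basis states `r₀`, `x₀` to
the first and `y₀`, `f₀` to the second, a unitary takes one to the other. -/
theorem exists_unitary_of_gram_eq {J A B F R : Type*} [Fintype J]
    [Fintype A] [Fintype B] [Fintype F] [Fintype R]
    [DecidableEq A] [DecidableEq B] [DecidableEq F] [DecidableEq R]
    (b : J → R → ℂ) (c : J → A → B → F → ℂ) (N : Matrix J J ℂ)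
    (hb : ∀ j l, N j l = ∑ r, b j r * star (b l r))
    (hc : ∀ j l x x', ∑ y, ∑ f, c j x y f * star (c l x' y f) = if x = x' then N j l else 0)
    (r₀ : R) (x₀ : A) (y₀ : B) (f₀ : F) :
    ∃ U : Matrix (R × A × B × F) (R × A × B × F) ℂ, Uᴴ * U = 1 ∧
      ∀ j x r x₁ y f, ∑ k, b j k * U (k, x, y₀, f₀) (r, x₁, y, f) =
        if r = r₀ then if x₁ = x₀ then c j x y f else 0 else 0 := by
  let M' : Matrix (J × A) (R × A × B × F) ℂ := fun j k =>
    if k.1 = r₀ then if k.2.1 = x₀ then c j.1 j.2 k.2.2.1 k.2.2.2 else 0 else 0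
  let B' : Matrix (J × A) (R × A × B × F) ℂ := fun j k =>
    if k.2.1 = j.2 then if k.2.2.1 = y₀ then if k.2.2.2 = f₀ then b j.1 k.1 else 0 else 0 else 0
  have hMB : M' * M'ᴴ = B' * B'ᴴ := by
    ext ⟨j, x⟩ ⟨l, x'⟩
    rw [Matrix.mul_apply, Matrix.mul_apply]
    simp only [Matrix.conjTranspose_apply]
    simp only [M', B', Fintype.sum_prod_type]
    trans if x = x' then N j l else 0
    · rw [← hc]
      simp
    · rw [hb]
      by_cases hx : x = x'
      · subst hx
        simp
      · simp [hx]
  obtain ⟨U, hU, hMU⟩ := exists_unitary_eq_mul M' B' hMB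
  refine ⟨U, Matrix.mem_unitaryGroup_iff'.1 hU, fun j x r x₁ y f => ?_⟩
  have h1 := congrFun (congrFun hMU (j, x)) (r, x₁, y, f)
  rw [Matrix.mul_apply] at h1
  simp only [M', B', Fintype.sum_prod_type] at h1
  rw [h1]
  simp

/-- A strategy operator `P` has a dilation `v` by unitaries, with an initial register `ℂ^S` and a
final register `ℂ^R`. With the initial register in state `s₀` and the final one traced out it is
`P`; with the initial register traced out it is a reversed strategy that receives `ℂ^R` at its
start. As the turns are unitary, the total dimensions on the input and on the output side
agree. -/
theorem exists_dilation : ∀ {n : ℕ} {X : Fin n → Type uX} {Y : Fin n → Type uY}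
    [∀ i, Fintype (X i)] [∀ i, DecidableEq (X i)] [∀ i, Nonempty (X i)]
    [∀ i, Fintype (Y i)] [∀ i, DecidableEq (Y i)] [∀ i, Nonempty (Y i)]
    {P : Op Y X} (_ : P ∈ strategyOps n X Y),
    ∃ (S R : Type (max uX uY)) (_ : Fintype S) (_ : Fintype R) (_ : DecidableEq R) (s₀ : S)
      (v : S → Idx Y X → R → ℂ),
      (∀ p q, P p q = ∑ r, v s₀ p r * star (v s₀ q r)) ∧
      (fun p q => ∑ s, v s p.2 p.1 * star (v s q.2 q.1)) ∈ revStrategyOps R n X Y ∧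
      Fintype.card (∀ i, X i) * Fintype.card S = Fintype.card (∀ i, Y i) * Fintype.card R := by
  intro n
  induction n with
  | zero =>
    intro X Y _ _ _ _ _ _ P hP
    refine ⟨PUnit, PUnit, inferInstance, inferInstance, inferInstance, PUnit.unit,
      fun _ _ _ => 1, ?_, ?_, by simp⟩
    · intro p q
      rw [Set.mem_singleton_iff.1 hP, Subsingleton.elim p q]
      simp
    · refine Set.mem_singleton_iff.2 ?_
      ext p q
      simp
  | succ n ih =>
    intro X Y _ _ _ _ _ _ P hP
    obtain ⟨hPpos, N, hN, hPN⟩ := hP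
    obtain ⟨S, R, _, _, _, s₀, v, hv, hrev, hcard⟩ := ih hN
    obtain ⟨C, hC⟩ := exists_eq_mul_conjTranspose hPpos
    let xb : X (Fin.last n) := Classical.arbitrary _
    let yb : Y (Fin.last n) := Classical.arbitrary _
    let fb : Idx Y X := Classical.arbitrary _
    have hR : Nonempty R := by
      have h1 : 0 < Fintype.card (∀ i : Fin n, X i.castSucc) * Fintype.card S :=
        Nat.mul_pos Fintype.card_pos (Fintype.card_pos_iff.2 ⟨s₀⟩)
      rw [hcard] at h1
      exact Fintype.card_pos_iff.1 (Nat.pos_of_mul_pos_left h1)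
    let rb : R := Classical.arbitrary R
    have hgram : ∀ (j l : Idx (fun i : Fin n => Y i.castSucc) (fun i : Fin n => X i.castSucc))
        (x x' : X (Fin.last n)),
        ∑ y, ∑ f, C (Fin.snoc j.1 y, Fin.snoc j.2 x) f *
          star (C (Fin.snoc l.1 y, Fin.snoc l.2 x') f) = if x = x' then N j l else 0 := by
      intro j l x x'
      have h1 := congrFun (congrFun hPN (j.1, Fin.snoc j.2 x)) (l.1, Fin.snoc l.2 x')
      simp only [tensorIdLast, Matrix.submatrix_apply, Matrix.kroneckerMap_apply,
        Fin.init_snoc, Fin.snoc_last, Matrix.one_apply, mul_ite, mul_one, mul_zero] at h1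
      rw [← h1]
      simp only [partialTraceLast, hC, Matrix.mul_apply, Matrix.conjTranspose_apply]
    obtain ⟨U, hU, hbU⟩ := exists_unitary_of_gram_eq (v s₀)
      (fun j x y f => C (Fin.snoc j.1 y, Fin.snoc j.2 x) f) N hv hgram rb xb yb fb
    let a : (Y (Fin.last n) × Idx Y X) → (R × X (Fin.last n) × Idx Y X) → Y (Fin.last n) →
        X (Fin.last n) → R → ℂ := fun e r y x k => U (k, x, e.1, e.2) (r.1, r.2.1, y, r.2.2)
    have ha : ∀ r y r' y', ∑ x, ∑ e, ∑ k, a e r y x k * star (a e r' y' x k) =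
        if r = r' ∧ y = y' then 1 else 0 := by
      rintro ⟨r, x₁, f⟩ y ⟨r', x₁', f'⟩ y'
      have h1 := congrFun (congrFun hU (r', x₁', y', f')) (r, x₁, y, f)
      rw [Matrix.mul_apply, Fintype.sum_prod_type, Finset.sum_comm, Fintype.sum_prod_type] at h1
      simp only [Matrix.conjTranspose_apply, Matrix.one_apply, Prod.mk.injEq] at h1
      simp only [a, Prod.mk.injEq]
      simp_rw [mul_comm _ (star _)]
      refine h1.trans (if_congr ?_ rfl rfl)
      exact ⟨fun ⟨h₁, h₂, h₃, h₄⟩ => ⟨⟨h₁.symm, h₂.symm, h₄.symm⟩, h₃.symm⟩,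
        fun ⟨⟨h₁, h₂, h₄⟩, h₃⟩ => ⟨h₁.symm, h₂.symm, h₃.symm, h₄.symm⟩⟩
    -- The registers `Y (Fin.last n)` and `Idx Y X` are auxiliary; the second is large enough to
    -- hold a purification of `P`, and both keep the new turn unitary.
    refine ⟨(Y (Fin.last n) × Idx Y X) × S, R × X (Fin.last n) × Idx Y X, inferInstance,
      inferInstance, inferInstance, ((yb, fb), s₀),
      fun em p r => ∑ k, a em.1 r (p.1 (Fin.last n)) (p.2 (Fin.last n)) k *
        v em.2 (Fin.init p.1, Fin.init p.2) k, ?_, ?_, ?_⟩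
    · have hvM : ∀ (p : Idx Y X) (r : R × X (Fin.last n) × Idx Y X),
          ∑ k, a (yb, fb) r (p.1 (Fin.last n)) (p.2 (Fin.last n)) k *
            v s₀ (Fin.init p.1, Fin.init p.2) k =
          if r.1 = rb then if r.2.1 = xb then C p r.2.2 else 0 else 0 := by
        rintro ⟨p1, p2⟩ ⟨r, x, f⟩
        have h1 := hbU (Fin.init p1, Fin.init p2) (p2 (Fin.last n)) r x (p1 (Fin.last n)) f
        simp only [Fin.snoc_init_self] at h1
        rw [← h1]
        exact Finset.sum_congr rfl fun _ _ => mul_comm _ _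
      intro p q
      simp only [hvM, hC, Matrix.mul_apply, Matrix.conjTranspose_apply, Fintype.sum_prod_type]
      simp
    · have := appendTurn_mem_revStrategyOps a ha hrev
      rwa [appendTurn_eq a fun s p => v s p.2 p.1] at this
    · simp only [Fintype.card_prod, Fintype.card_pi, Fin.prod_univ_castSucc] at hcard ⊢
      linear_combination (Fintype.card (X (Fin.last n)) * Fintype.card (Y (Fin.last n)) *
        ((∏ i : Fin n, Fintype.card (Y i.castSucc)) * Fintype.card (Y (Fin.last n)) *
          ((∏ i : Fin n, Fintype.card (X i.castSucc)) * Fintype.card (X (Fin.last n))))) * hcard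

/-! ### Reversing the order of the turns -/

/-- Reversal of a dependent tuple along bijections `A' i ≃ A j` for `i = j.rev`. The bijections
allow `A' i` to be `A i.rev` and also to be a restriction of such a family, where the two types are not
definitionally equal. -/
def revMap {n : ℕ} {A A' : Fin n → Type*} (e : ∀ i j : Fin n, i = j.rev → A' i ≃ A j)
    (x : ∀ i, A' i) : ∀ j, A j := fun j => e j.rev j rfl (x j.rev)

theorem revMap_apply {n : ℕ} {A A' : Fin n → Type*} (e : ∀ i j : Fin n, i = j.rev → A' i ≃ A j)
    (x : ∀ i, A' i) (i j : Fin n) (h : i = j.rev) : revMap e x j = e i j h (x i) := by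
  subst h; rfl

theorem revMap_snoc {n : ℕ} {A A' : Fin (n + 1) → Type*}
    (e : ∀ i j : Fin (n + 1), i = j.rev → A' i ≃ A j)
    (x : ∀ i : Fin n, A' i.castSucc) (b : A' (Fin.last n)) :
    revMap e (Fin.snoc x b) = Fin.cons (e (Fin.last n) 0 (Fin.rev_zero n).symm b)
      (revMap (A := fun j => A j.succ) (A' := fun i => A' i.castSucc)
        (fun i j h => e i.castSucc j.succ (by rw [Fin.rev_succ, h])) x) := by
  funext j
  refine Fin.cases ?_ (fun j => ?_) j
  · rw [revMap_apply e _ (Fin.last n) 0 (Fin.rev_zero n).symm, Fin.snoc_last, Fin.cons_zero]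
  · rw [revMap_apply e _ j.rev.castSucc j.succ (by rw [Fin.rev_succ]), Fin.snoc_castSucc,
      Fin.cons_succ]
    rfl

/-- Feeding the pure state with amplitudes `z` into the extra input register of a reversed strategy
gives an ordinary strategy for the reversed families of spaces. -/
theorem contraction_mem_strategyOps {R : Type w} [DecidableEq R] [Fintype R] (z : R → ℂ)
    (hz : star z ⬝ᵥ z = 1) :
    ∀ {n : ℕ} {X X' : Fin n → Type uX} {Y Y' : Fin n → Type uY}
      [∀ i, Fintype (X i)] [∀ i, Fintype (X' i)] [∀ i, DecidableEq (X' i)]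
      [∀ i, Fintype (Y i)] [∀ i, Fintype (Y' i)] [∀ i, DecidableEq (Y i)] [∀ i, DecidableEq (Y' i)]
      (eX : ∀ i j : Fin n, i = j.rev → X' i ≃ X j) (eY : ∀ i j : Fin n, i = j.rev → Y' i ≃ Y j)
      {Z : Matrix (R × Idx Y X) (R × Idx Y X) ℂ} (_ : Z ∈ revStrategyOps R n X Y),
      (fun p q => ∑ k, ∑ l, z k * Z (k, revMap eY p.2, revMap eX p.1)
          (l, revMap eY q.2, revMap eX q.1) * star (z l) : Op X' Y') ∈ strategyOps n Y' X' := by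
  intro n
  induction n with
  | zero =>
    intro X X' Y Y' _ _ _ _ _ _ _ eX eY Z hZ
    refine Set.mem_singleton_iff.2 ?_
    ext p q
    rw [Set.mem_singleton_iff.1 hZ, Subsingleton.elim p q, Matrix.one_apply_eq]
    refine Eq.trans ?_ hz
    simp [dotProduct, mul_comm]
  | succ n ih =>
    intro X X' Y Y' _ _ _ _ _ _ _ eX eY Z hZ
    refine ⟨?_, _, ih (fun i j h => eX i.castSucc j.succ (by rw [Fin.rev_succ, h]))
      (fun i j h => eY i.castSucc j.succ (by rw [Fin.rev_succ, h])) hZ.2.choose_spec.1, ?_⟩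
    · obtain ⟨C, hC⟩ := exists_eq_mul_conjTranspose hZ.1
      have := posSemidef_sum_mul_star (fun m (p : Idx X' Y') =>
        ∑ k, z k * C (k, revMap eY p.2, revMap eX p.1) m)
      refine (congrArg Matrix.PosSemidef ?_).mpr this
      ext p q
      simp only [hC, Matrix.mul_apply, Matrix.conjTranspose_apply, Matrix.of_apply]
      simp_rw [star_sum, Finset.sum_mul_sum, Finset.mul_sum, Finset.sum_mul, star_mul']
      rw [Finset.sum_comm_cycle]
      exact Finset.sum_congr rfl fun _ _ => Finset.sum_congr rfl fun _ _ =>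
        Finset.sum_congr rfl fun _ _ => by ring
    · have hN := hZ.2.choose_spec.2
      set N := hZ.2.choose
      ext ⟨p1, p2⟩ ⟨q1, q2⟩
      let eX' : ∀ i j : Fin n, i = j.rev → X' i.castSucc ≃ X j.succ :=
        fun i j h => eX i.castSucc j.succ (by rw [Fin.rev_succ, h])
      let eY' : ∀ i j : Fin n, i = j.rev → Y' i.castSucc ≃ Y j.succ :=
        fun i j h => eY i.castSucc j.succ (by rw [Fin.rev_succ, h])
      have h0 : ∀ p : ∀ i, Y' i, revMap eY p 0 =
          eY (Fin.last n) 0 (Fin.rev_zero n).symm (p (Fin.last n)) := fun p =>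
        revMap_apply eY p _ _ _
      have htail : ∀ p : ∀ i, Y' i, Fin.tail (revMap eY p) =
          revMap (A := fun j => Y j.succ) (A' := fun i => Y' i.castSucc) eY' (Fin.init p) := by
        intro p
        conv_lhs => rw [← Fin.snoc_init_self p, revMap_snoc, Fin.tail_cons]
      have key : ∀ k l, ∑ b : X' (Fin.last n),
          Z (k, revMap eY p2, revMap eX (Fin.snoc p1 b))
            (l, revMap eY q2, revMap eX (Fin.snoc q1 b)) =
          if p2 (Fin.last n) = q2 (Fin.last n) then
            N (k, revMap (A := fun j => Y j.succ) (A' := fun i => Y' i.castSucc) eY' (Fin.init p2),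
                revMap (A := fun j => X j.succ) (A' := fun i => X' i.castSucc) eX' p1)
              (l, revMap (A := fun j => Y j.succ) (A' := fun i => Y' i.castSucc) eY' (Fin.init q2),
                revMap (A := fun j => X j.succ) (A' := fun i => X' i.castSucc) eX' q1)
          else 0 := by
        intro k l
        rw [← htail, ← htail]
        refine Eq.trans ?_ ((hN k l (revMap eY p2) (revMap eY q2)
          (revMap (A := fun j => X j.succ) (A' := fun i => X' i.castSucc) eX' p1)
          (revMap (A := fun j => X j.succ) (A' := fun i => X' i.castSucc) eX' q1)).trans
            (if_congr ?_ rfl rfl))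
        · refine Eq.trans ?_ ((eX (Fin.last n) 0 (Fin.rev_zero n).symm).sum_comp _)
          refine Finset.sum_congr rfl fun b _ => ?_
          rw [revMap_snoc, revMap_snoc]
        · rw [h0, h0, EmbeddingLike.apply_eq_iff_eq]
      change ∑ b, ∑ k, ∑ l, z k * Z (k, revMap eY p2, revMap eX (Fin.snoc p1 b))
        (l, revMap eY q2, revMap eX (Fin.snoc q1 b)) * star (z l) =
        (∑ k, ∑ l, z k *
          N (k, revMap (A := fun j => Y j.succ) (A' := fun i => Y' i.castSucc) eY' (Fin.init p2),
              revMap (A := fun j => X j.succ) (A' := fun i => X' i.castSucc) eX' p1)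
            (l, revMap (A := fun j => Y j.succ) (A' := fun i => Y' i.castSucc) eY' (Fin.init q2),
              revMap (A := fun j => X j.succ) (A' := fun i => X' i.castSucc) eX' q1) * star (z l)) *
        (1 : Matrix _ _ ℂ) (p2 (Fin.last n)) (q2 (Fin.last n))
      rw [Finset.sum_comm]
      simp_rw [Finset.sum_comm (s := (Finset.univ : Finset (X' (Fin.last n)))), ← Finset.sum_mul,
        ← Finset.mul_sum, key, Matrix.one_apply]
      split_ifs <;> simp

/-! ### Values of strategies on rank-one operators -/

theorem hsInner_rankOne {ι : Type*} [Fintype ι] (u : ι → ℂ) (A : Matrix ι ι ℂ) :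
    hsInner (rankOne u) A = ∑ p, ∑ q, star (u p) * A p q * u q := by
  simp only [hsInner, rankOne, Matrix.trace, Matrix.diag_apply, Matrix.mul_apply,
    Matrix.conjTranspose_apply, Matrix.vecMulVec_apply, Pi.star_apply, star_mul', star_star]
  rw [Finset.sum_comm]
  exact Finset.sum_congr rfl fun _ _ => Finset.sum_congr rfl fun _ _ => by ring

/-- The value of a sum of rank-one operators at `u` is the sum of the squared overlaps with `u`. -/
theorem hsInner_rankOne_sum {ι κ : Type*} [Fintype ι] [Fintype κ] (u : ι → ℂ) (c : κ → ι → ℂ) :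
    hsInner (rankOne u) (fun p q => ∑ m, c m p * star (c m q)) =
      ∑ m, (∑ p, star (u p) * c m p) * star (∑ p, star (u p) * c m p) := by
  refine (hsInner_rankOne u _).trans ?_
  simp_rw [star_sum, Finset.sum_mul_sum, Finset.mul_sum, Finset.sum_mul, star_mul', star_star]
  rw [Finset.sum_comm_cycle]
  exact Finset.sum_congr rfl fun _ _ => Finset.sum_congr rfl fun _ _ =>
    Finset.sum_congr rfl fun _ _ => by ring

/-- The identification of `A i.rev` with `A j` for `i = j.rev`. -/
def revCast {n : ℕ} (A : Fin n → Type*) (i j : Fin n) (h : i = j.rev) : A i.rev ≃ A j :=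
  Equiv.cast (by rw [h, Fin.rev_rev])

theorem revCast_apply {n : ℕ} (A : Fin n → Type*) (x : ∀ i, A i) (i j : Fin n) (h : i = j.rev) :
    revCast A i j h (x i.rev) = x j := by
  subst h
  refine eq_of_heq ((cast_heq _ _).trans ?_)
  rw [Fin.rev_rev]

theorem revMap_revCast {n : ℕ} (A : Fin n → Type*) (x : ∀ i, A i) :
    revMap (A' := fun i => A i.rev) (revCast A) (fun i => x i.rev) = x :=
  funext fun j => revCast_apply A x j.rev j rfl

theorem revMap_revCast_rev {n : ℕ} (A : Fin n → Type*) (x : ∀ i : Fin n, A i.rev) :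
    (fun i : Fin n => revMap (A' := fun i => A i.rev) (revCast A) x i.rev) = x := by
  funext i
  rw [revMap_apply (A' := fun i => A i.rev) (revCast A) x i i.rev (Fin.rev_rev i).symm]
  rfl

/-- The permutation of the standard basis performed by the isometry `W`. -/
def idxRev {n : ℕ} (Y : Fin n → Type uY) (X : Fin n → Type uX) :
    Idx Y X ≃ Idx (fun i => X i.rev) (fun i => Y i.rev) where
  toFun p := (fun i => p.2 i.rev, fun i => p.1 i.rev)
  invFun q := (revMap (revCast Y) q.2, revMap (revCast X) q.1)
  left_inv p := Prod.ext (revMap_revCast Y p.1) (revMap_revCast X p.2)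
  right_inv q := Prod.ext (revMap_revCast_rev X q.1) (revMap_revCast_rev Y q.2)

theorem hsInner_reversal {n : ℕ} (X : Fin n → Type uX) (Y : Fin n → Type uY)
    [∀ i, Fintype (X i)] [∀ i, DecidableEq (X i)] [∀ i, Fintype (Y i)] [∀ i, DecidableEq (Y i)]
    (u : Idx Y X → ℂ) (Q : Op (fun i => X i.rev) (fun i => Y i.rev)) :
    hsInner (reversal Y X * rankOne u * (reversal Y X)ᴴ) Q =
      hsInner (rankOne u) (Q.submatrix (idxRev Y X) (idxRev Y X)) := by
  have h1 : reversal Y X * rankOne u * (reversal Y X)ᴴ = rankOne (reversal Y X *ᵥ u) := by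
    rw [rankOne, rankOne, Matrix.mul_vecMulVec, Matrix.vecMulVec_mul, Matrix.star_mulVec]
  have h2 : ∀ p, (reversal Y X *ᵥ u) (idxRev Y X p) = u p := by
    intro p
    have : ∀ p', reversal Y X (idxRev Y X p) p' = if p = p' then 1 else 0 := fun p' =>
      if_congr (idxRev Y X).apply_eq_iff_eq rfl rfl
    simp [Matrix.mulVec, dotProduct, this]
  rw [h1, hsInner_rankOne, hsInner_rankOne, ← (idxRev Y X).sum_comp]
  refine Finset.sum_congr rfl fun p _ => ?_
  rw [← (idxRev Y X).sum_comp]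
  simp only [h2, Matrix.submatrix_apply]

/-- With `G` the matrix of overlaps of `u` with the vectors `v s · r`, each unit vector `z` gives a
reversed strategy of value `‖G z‖²`. -/
theorem exists_strategy_value_eq {n : ℕ} {X : Fin n → Type uX} {Y : Fin n → Type uY}
    [∀ i, Fintype (X i)] [∀ i, DecidableEq (X i)] [∀ i, Fintype (Y i)] [∀ i, DecidableEq (Y i)]
    {S R : Type*} [Fintype S] [Fintype R] [DecidableEq R] {v : S → Idx Y X → R → ℂ}
    (hv : (fun p q => ∑ s, v s p.2 p.1 * star (v s q.2 q.1)) ∈ revStrategyOps R n X Y)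
    (u : Idx Y X → ℂ) (z : R → ℂ) (hz : star z ⬝ᵥ z = 1) :
    ∃ Q ∈ strategyOps n (fun i => Y i.rev) (fun i => X i.rev),
      hsInner (reversal Y X * rankOne u * (reversal Y X)ᴴ) Q =
        star ((Matrix.of fun s r => ∑ p, star (u p) * v s p r) *ᵥ z) ⬝ᵥ
          ((Matrix.of fun s r => ∑ p, star (u p) * v s p r) *ᵥ z) := by
  refine ⟨_, contraction_mem_strategyOps z hz (X' := fun i => X i.rev) (Y' := fun i => Y i.rev)
    (revCast X) (revCast Y) hv, ?_⟩
  refine (hsInner_reversal X Y u _).trans ?_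
  trans hsInner (rankOne u) (fun p q => ∑ s, (∑ k, z k * v s p k) * star (∑ k, z k * v s q k))
  · congr 1
    ext p q
    change ∑ k, ∑ l, z k * (∑ s, v s ((idxRev Y X).symm (idxRev Y X p)) k *
      star (v s ((idxRev Y X).symm (idxRev Y X q)) l)) * star (z l) = _
    rw [Equiv.symm_apply_apply, Equiv.symm_apply_apply]
    simp_rw [star_sum, Finset.sum_mul_sum, Finset.mul_sum, Finset.sum_mul, star_mul']
    rw [Finset.sum_comm_cycle]
    exact Finset.sum_congr rfl fun _ _ => Finset.sum_congr rfl fun _ _ =>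
      Finset.sum_congr rfl fun _ _ => by ring
  · refine (hsInner_rankOne_sum u _).trans ?_
    refine Finset.sum_congr rfl fun s _ => ?_
    have : ∑ p, star (u p) * ∑ k, z k * v s p k =
        ((Matrix.of fun s r => ∑ p, star (u p) * v s p r) *ᵥ z) s := by
      simp only [Matrix.mulVec, dotProduct, Matrix.of_apply, Finset.sum_mul, Finset.mul_sum]
      rw [Finset.sum_comm]
      exact Finset.sum_congr rfl fun _ _ => Finset.sum_congr rfl fun _ _ => by ring
    rw [this, mul_comm]
    rfl

end QStrategy

end

theorem theorem1 {n : ℕ} (hn : 1 ≤ n)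
    (X : Fin n → Type uX) (Y : Fin n → Type uY)
    [∀ i, Fintype (X i)] [∀ i, DecidableEq (X i)] [∀ i, Nonempty (X i)]
    [∀ i, Fintype (Y i)] [∀ i, DecidableEq (Y i)] [∀ i, Nonempty (Y i)]
    (u : QStrategy.Idx Y X → ℂ)
    (P : QStrategy.Op Y X) (hP : P ∈ QStrategy.strategyOps n X Y) :
    (∃ Q ∈ QStrategy.strategyOps n (fun i => Y i.rev) (fun i => X i.rev),
      QStrategy.hsInner (QStrategy.rankOne u) P ≤
        QStrategy.hsInner
          (QStrategy.reversal Y X * QStrategy.rankOne u * (QStrategy.reversal Y X)ᴴ) Q) ∧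
    (Module.finrank ℂ (EuclideanSpace ℂ (∀ i, Y i)) ≤
        Module.finrank ℂ (EuclideanSpace ℂ (∀ i, X i)) →
      ∃ Q ∈ QStrategy.strategyOps n (fun i => Y i.rev) (fun i => X i.rev),
        QStrategy.hsInner
          (QStrategy.reversal Y X * QStrategy.rankOne u * (QStrategy.reversal Y X)ᴴ) Q =
        QStrategy.hsInner (QStrategy.rankOne u) P) := by
  obtain ⟨S, R, _, _, _, s₀, v, hv, hrev, hcard⟩ := QStrategy.exists_dilation hP
  let G : Matrix S R ℂ := Matrix.of fun s r => ∑ p, star (u p) * v s p r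
  have hval : QStrategy.hsInner (QStrategy.rankOne u) P = (G * Gᴴ) s₀ s₀ := by
    have : P = fun p q => ∑ r, v s₀ p r * star (v s₀ q r) := Matrix.ext hv
    rw [this]
    exact QStrategy.hsInner_rankOne_sum u fun r p => v s₀ p r
  have hX : 0 < Fintype.card (∀ i, X i) := Fintype.card_pos
  have hR : Nonempty R := by
    have h1 : 0 < Fintype.card (∀ i, Y i) * Fintype.card R := by
      rw [← hcard]
      exact Nat.mul_pos hX (Fintype.card_pos_iff.2 ⟨s₀⟩)
    exact Fintype.card_pos_iff.1 (Nat.pos_of_mul_pos_left h1)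
  constructor
  · obtain ⟨z, hz, hzG⟩ := QStrategy.exists_unit_vector_sq_le G s₀
    obtain ⟨Q, hQ, hQz⟩ := QStrategy.exists_strategy_value_eq hrev u z hz
    exact ⟨Q, hQ, by rw [hval, hQz]; exact hzG⟩
  · intro hdim
    rw [finrank_euclideanSpace, finrank_euclideanSpace] at hdim
    have hSR : Fintype.card S ≤ Fintype.card R := by
      refine Nat.le_of_mul_le_mul_left ?_ hX
      rw [hcard]
      exact Nat.mul_le_mul_right _ hdim
    obtain ⟨z, hz, hzG⟩ := QStrategy.exists_unit_vector_sq_eq G s₀ hSR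
    obtain ⟨Q, hQ, hQz⟩ := QStrategy.exists_strategy_value_eq hrev u z hz
    exact ⟨Q, hQ, by rw [hval, hQz]; exact hzG⟩
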